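/- **Setting.** There are finite sets $\mathcal A$ of $n_a$ analysis units and $\mathcal R$ of $n_r$ randomization units. The treatment vector $\mathbf T=(T_r)_{r\in\mathcal R}\in\{0,1\}^{n_r}$ has independent Bernoulli($p$) coordinates, $0<p<1$, and it is the only source of randomness. For $a\in\mathcal A$, $r\in\mathcal R$ there are an edge function $E_{ar}:\{0,1\}^{n_r}\to\{0,1\}$ and a potential outcome function $Y_a:\{0,1\}^{n_r}\to\mathbb R$; $Y_a(\mathbf T)$ depends only on the set $\{r: E_{ar}(\mathbf T)=1\}$ and on the treatments of the units in that set. Write $e_{ar}=E_{ar}(\mathbf T)$ and $y_a=Y_a(\mathbf T)$. Given real weights $w_{ar},u_{ar},c_{ar}$, put $x_a=\sum_r T_re_{ar}w_{ar}$, $z_a=\sum_r T_ru_{ar}$ and assume the linear model $y_a=\alpha_a+\beta_ax_a$ with constants $\alpha_a,\beta_a$. The total treatment effect and its estimator are $$\mu=\frac1{n_a}\sum_a\bigl[Y_a(\mathbf 1)-Y_a(\mathbf 0)\bigr],\qquad \hat\mu^{u,c}=\frac1{n_a}\sum_a\frac{y_a(z_a-\mathbb E z_a)}{\mathrm{Cov}(x_a,z_a)}\sum_r\Bigl(\frac{T_rw_{ar}(e_{ar}-c_{ar})}{p}+w_{ar}c_{ar}\Bigr).$$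 Let $R_a=\{r: E_{ar}(\mathbf 1)=1\}$, $A_r=\{a: E_{ar}(\mathbf 1)=1\}$, $V_a=\{r: u_{ar}\neq0\}$, $d_{\mathcal A}=\max_a|R_a|$, $d_{\mathcal R}=\max_r|A_r|$. **Assumptions.** Let $G\subset\mathcal A\times\mathcal R$ be an anchor subgraph, i.e. $E_{ar}(\mathbf t)=1$ for all $(a,r)\in G$ and all $\mathbf t\in\{0,1\}^{n_r}$. Assume that 1. edges are $r$-driven: $E_{ar}(\mathbf t)$ depends only on $t_r$; 2. $u_{ar}\ne0$ implies $(a,r)\in G$; $c_{ar}=1$ if $(a,r)\in G$ and $c_{ar}=0$ otherwise; $w_{ar}\neq0$ for $(a,r)\in G$; and $V_a\ne\emptyset$ for every $a$; 3. $u_{ar}\ge0$ for all $a,r$; 4. $W_l/|R_a|\le|w_{ar}|\le W_h/|R_a|$ for all $a$ and $r\in R_a$, and for each $a$ the weights $w_{ar}$, $r\in V_a$, all have the same sign; 5. $|Y_a(\mathbf t)|\le M$ for all $a$ and $\mathbf t$; 6. $p\ge\delta$ and $1-p\ge\delta$. Here $\delta,W_l,W_h,M>0$ are fixed constants. **Theorem.**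 (i) There is a constant $C$ depending only on $\delta,W_l,W_h,M$ such that every experiment satisfying these assumptions has $\mathrm{Var}(\hat\mu^{u,c})\le C\,d_{\mathcal A}^3d_{\mathcal R}/n_a$. Consequently, for every sequence of experiments satisfying the assumptions with the same constants and with $d_{\mathcal A}^3d_{\mathcal R}/n_a\to0$, the estimator is consistent: $\hat\mu^{u,c}-\mu\to0$ in probability. (ii) For every sequence of experiments satisfying the assumptions with the same constants, if $n_a\mathrm{Var}(\hat\mu^{u,c})$ is bounded away from zero and $d_{\mathcal A}^{10}d_{\mathcal R}^4/n_a\to0$, then $(\hat\mu^{u,c}-\mu)/\sqrt{\mathrm{Var}(\hat\mu^{u,c})}$ converges in distribution to $\mathcal N(0,1)$. -/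

import Mathlib

open MeasureTheory ProbabilityTheory Filter Topology

/-- Numerical value of a binary variable: `true ↦ 1`, `false ↦ 0`. -/
def bitVal (b : Bool) : ℝ := if b then 1 else 0

/-- An endogenous bipartite interference graph on analysis units `A` and randomization units `R`.
Treatment assignments are the elements of `R → Bool`. `E a r T` tells whether the edge `(a, r)`
exists under `T`, and `Y a T` is the potential outcome of `a` under `T`. The outcome of `a` may
only depend on the set of units `a` is connected to and on the treatments of those units. -/
structure EndogenousBipartiteGraph (A R : Type*) where
  E : A → R → (R → Bool) → Bool
  Y : A → (R → Bool) → ℝ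
  outcome_eq : ∀ (a : A) (T T' : R → Bool),
    {r | E a r T = true} = {r | E a r T' = true} →
    (∀ r, E a r T = true → T r = T' r) → Y a T = Y a T'

/-- A bipartite experiment: an endogenous bipartite interference graph, together with the treatment
probability `p`, the edge weights `w`, the instrument weights `u`, the augmentation constants `c`
and a set `G` of pairs (the candidate anchor subgraph). -/
structure BipartiteExperiment (A R : Type*) extends EndogenousBipartiteGraph A R where
  p : unitInterval
  w : A → R → ℝ
  u : A → R → ℝ
  c : A → R → ℝ
  G : Set (A × R)

namespace BipartiteExperiment

/-- `G` is an anchor subgraph: its edges exist under every treatment assignment. -/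
def IsAnchor {A R : Type*} (X : BipartiteExperiment A R) : Prop :=
  ∀ a r, (a, r) ∈ X.G → ∀ T, X.E a r T = true

/-- Edges are `r`-driven: `E a r` depends on the treatment of `r` only. -/
def RDriven {A R : Type*} (X : BipartiteExperiment A R) : Prop :=
  ∀ (a : A) (r : R) (T T' : R → Bool), T r = T' r → X.E a r T = X.E a r T'

noncomputable section

variable {A R : Type*} [Fintype A] [Fintype R] (X : BipartiteExperiment A R)

/-- The law of the treatment vector: independent Bernoulli(`p`) coordinates. -/
def law : Measure (R → Bool) := Measure.pi fun _ => bernoulliMeasure true false X.p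

instance : IsProbabilityMeasure X.law := by
  unfold law; infer_instance

/-- Treatment exposure `x_a = ∑_r T_r e_{ar} w_{ar}`. -/
def exposure (a : A) (T : R → Bool) : ℝ := ∑ r, bitVal (T r) * bitVal (X.E a r T) * X.w a r

/-- The generalized linear exposure-response model `y_a = α_a + β_a x_a`. -/
def LinearOutcomes : Prop :=
  ∃ α β : A → ℝ, ∀ a T, X.Y a T = α a + β a * X.exposure a T

/-- The instrument `z_a = ∑_r T_r u_{ar}`. -/
def instrument (a : A) (T : R → Bool) : ℝ := ∑ r, bitVal (T r) * X.u a r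

/-- The estimator `y_a (z_a - 𝔼 z_a) / Cov(x_a, z_a)` of the slope of unit `a`. -/
def betaHat (a : A) (T : R → Bool) : ℝ :=
  X.Y a T * (X.instrument a T - ∫ T', X.instrument a T' ∂X.law) /
    covariance (X.exposure a) (X.instrument a) X.law

/-- The augmented inverse probability weighted estimator of the total edge weight of `a`
under full treatment, `∑_r (T_r w_{ar} (e_{ar} - c_{ar}) / p + w_{ar} c_{ar})`. -/
def weightHat (a : A) (T : R → Bool) : ℝ :=
  ∑ r, (bitVal (T r) * X.w a r * (bitVal (X.E a r T) - X.c a r) / (X.p : ℝ) + X.w a r * X.c a r)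

/-- The estimator of the total treatment effect. -/
def muHat (T : R → Bool) : ℝ :=
  1 / (Fintype.card A : ℝ) * ∑ a, X.betaHat a T * X.weightHat a T

/-- The total treatment effect. -/
def tte : ℝ :=
  1 / (Fintype.card A : ℝ) * ∑ a, (X.Y a (fun _ => true) - X.Y a (fun _ => false))

/-- Variance of the estimator under the treatment assignment. -/
def varMuHat : ℝ := variance X.muHat X.law

/-- `R_a`: the randomization units connected to `a` under full treatment. -/
def unitsOf (a : A) : Finset R := {r | X.E a r (fun _ => true) = true}

/-- `A_r`: the analysis units connected to `r` under full treatment. -/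
def analysisOf (r : R) : Finset A := {a | X.E a r (fun _ => true) = true}

/-- `d_A = max_a |R_a|`. -/
def degA : ℕ := Finset.univ.sup fun a => (X.unitsOf a).card

/-- `d_R = max_r |A_r|`. -/
def degR : ℕ := Finset.univ.sup fun r => (X.analysisOf r).card

/-- The conditions under which the estimator is unbiased; independence of the Bernoulli
treatments is part of `law`. -/
structure BasicAssumptions : Prop where
  linear : X.LinearOutcomes
  anchor : X.IsAnchor
  rDriven : X.RDriven
  p_pos : 0 < (X.p : ℝ)
  p_lt_one : (X.p : ℝ) < 1
  u_support : ∀ a r, X.u a r ≠ 0 → (a, r) ∈ X.G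
  c_eq : ∀ a r, X.c a r = X.G.indicator (fun _ => (1 : ℝ)) (a, r)
  w_ne_zero : ∀ a r, (a, r) ∈ X.G → X.w a r ≠ 0
  u_nontrivial : ∀ a, ∃ r, X.u a r ≠ 0

/-- The conditions for consistency and asymptotic normality, with bounds `δ`, `Wl`, `Wh`, `M`.
`same_sign` says that, for each analysis unit, the edge weights on which the instrument is
supported have a common sign. -/
structure AsymptoticAssumptions (δ Wl Wh M : ℝ) : Prop extends X.BasicAssumptions where
  p_lower : δ ≤ (X.p : ℝ)
  p_upper : δ ≤ 1 - (X.p : ℝ)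
  u_nonneg : ∀ a r, 0 ≤ X.u a r
  same_sign : ∀ a r r', X.u a r ≠ 0 → X.u a r' ≠ 0 → 0 < X.w a r * X.w a r'
  w_lower : ∀ a, ∀ r ∈ X.unitsOf a, Wl / ((X.unitsOf a).card : ℝ) ≤ |X.w a r|
  w_upper : ∀ a, ∀ r ∈ X.unitsOf a, |X.w a r| ≤ Wh / ((X.unitsOf a).card : ℝ)
  bounded : ∀ a T, |X.Y a T| ≤ M

end

end BipartiteExperiment

/-! Write `τ_a` for `betaHat a * weightHat a`; the estimator is the average of the `τ_a`. Since
edges are `r`-driven, `T_r e_{ar}` equals `T_r` on `R_a` and `0` elsewhere. With the linear outcome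
model, `τ_a` is therefore a function of the treatments in `R_a` alone. Hence `τ_a` and `τ_b` are
independent unless `R_a` meets `R_b`, and each `a` has at most `D = d_A d_R` overlapping indices.

Unbiasedness comes from splitting `R_a` into anchors and non-anchors: the instrument lives on the
anchors, and the random part of `weightHat` lives on the non-anchors. Sign and size conditions keep
the covariance in the denominator away from zero, so `|τ_a| ≤ K d_A`
(`abs_betaHat_mul_weightHat_le`). Only overlapping pairs contribute to the variance, which is thus
of order `n D (K d_A)² / n²`; Chebyshev gives consistency.

Normality is Stein's method on characteristic functions. For a standardized locally dependent sum
`W` with characteristic function `φ`, removing the neighbours of `a` from `W` leaves something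
independent of the `a`-th term, whence `φ'(t) ≈ -t φ(t)` (`norm_integral_mul_exp_sub_le`). The
integrating factor `exp(t²/2)` turns this into `φ(t) ≈ exp(-t²/2)` (`norm_charFun_sub_gaussian_le`),
and Lévy's continuity theorem concludes. -/

/-! ### Independence across disjoint coordinate sets. -/

section FiniteProduct

variable {R α : Type*} [Fintype R] [Finite α] [MeasurableSpace α]
  [MeasurableSingletonClass α] {ν : R → Measure α} [∀ r, IsProbabilityMeasure (ν r)]

/-- Functions of disjoint sets of coordinates are independent under a product measure. -/
theorem DependsOn.indepFun_pi {β γ : Type*} [Nonempty β] [Nonempty γ] [MeasurableSpace β]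
    [MeasurableSpace γ] {f : (R → α) → β} {g : (R → α) → γ} {s t : Finset R}
    (hf : DependsOn f (s : Set R)) (hg : DependsOn g (t : Set R)) (hst : Disjoint s t) :
    IndepFun f g (Measure.pi ν) := by
  obtain ⟨f', rfl⟩ := dependsOn_iff_exists_comp.1 hf
  obtain ⟨g', rfl⟩ := dependsOn_iff_exists_comp.1 hg
  have h := (iIndepFun_pi (μ := ν) (X := fun _ x => x) fun _ => aemeasurable_id).indepFun_finset
    s t hst fun i => measurable_pi_apply i
  exact h.comp (φ := f') (ψ := g') (Measurable.of_discrete) (Measurable.of_discrete)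

theorem DependsOn.integral_mul_pi {𝕜 : Type*} [RCLike 𝕜] {f g : (R → α) → 𝕜} {s t : Finset R}
    (hf : DependsOn f (s : Set R)) (hg : DependsOn g (t : Set R)) (hst : Disjoint s t) :
    ∫ x, f x * g x ∂Measure.pi ν = (∫ x, f x ∂Measure.pi ν) * ∫ x, g x ∂Measure.pi ν :=
  (hf.indepFun_pi hg hst).integral_fun_mul_eq_mul_integral .of_discrete .of_discrete

theorem DependsOn.covariance_pi_eq_zero {f g : (R → α) → ℝ} {s t : Finset R}
    (hf : DependsOn f (s : Set R)) (hg : DependsOn g (t : Set R)) (hst : Disjoint s t) :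
    covariance f g (Measure.pi ν) = 0 :=
  (hf.indepFun_pi hg hst).covariance_eq_zero .of_discrete .of_discrete

end FiniteProduct

section DependsOnClosure

variable {ι β γ δ : Type*} {α : ι → Type*}

theorem DependsOn.comp_left {f : (Π i, α i) → β} {s : Set ι} (hf : DependsOn f s) (φ : β → γ) :
    DependsOn (fun x => φ (f x)) s :=
  fun _ _ h => congrArg φ (hf h)

theorem DependsOn.comp₂ {f : (Π i, α i) → β} {g : (Π i, α i) → γ} {s : Set ι}
    (hf : DependsOn f s) (hg : DependsOn g s) (φ : β → γ → δ) :
    DependsOn (fun x => φ (f x) (g x)) s :=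
  fun _ _ h => congrArg₂ φ (hf h) (hg h)

theorem DependsOn.finset_sum {κ : Type*} [AddCommMonoid β] {f : κ → (Π i, α i) → β} {s : Set ι}
    {J : Finset κ} (hf : ∀ j ∈ J, DependsOn (f j) s) :
    DependsOn (fun x => ∑ j ∈ J, f j x) s :=
  fun _ _ h => Finset.sum_congr rfl fun j hj => hf j hj h

end DependsOnClosure

/-! ### Elementary inequalities. -/

/-- Two variables bounded by `B` have covariance at most `2 B ^ 2`. -/
theorem covariance_le_of_abs_le {Ω : Type*} [MeasurableSpace Ω] {μ : Measure Ω}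
    [IsProbabilityMeasure μ] {f g : Ω → ℝ} (hf : AEStronglyMeasurable f μ)
    (hg : AEStronglyMeasurable g μ) {B : ℝ} (hfB : ∀ x, |f x| ≤ B) (hgB : ∀ x, |g x| ≤ B) :
    covariance f g μ ≤ 2 * B ^ 2 := by
  have hf2 : MemLp f 2 μ := MemLp.of_bound hf B (.of_forall hfB)
  have hg2 : MemLp g 2 μ := MemLp.of_bound hg B (.of_forall hgB)
  have hx : ∀ (h : Ω → ℝ) (C : ℝ), (∀ x, |h x| ≤ C) → |∫ x, h x ∂μ| ≤ C := fun h C hh => by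
    simpa using norm_integral_le_of_norm_le_const (μ := μ) (f := h) (.of_forall hh)
  rw [covariance_eq_sub hf2 hg2]
  have h1 := hx (f * g) (B * B) fun x => by
    simp only [Pi.mul_apply, abs_mul]
    exact mul_le_mul (hfB x) (hgB x) (abs_nonneg _) ((abs_nonneg _).trans (hfB x))
  have h2 : |(∫ x, f x ∂μ) * ∫ x, g x ∂μ| ≤ B * B := by
    rw [abs_mul]
    exact mul_le_mul (hx f B hfB) (hx g B hgB) (abs_nonneg _) ((abs_nonneg _).trans (hx f B hfB))
  linarith [le_abs_self (∫ x, (f * g) x ∂μ), neg_abs_le ((∫ x, f x ∂μ) * ∫ x, g x ∂μ)]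

/-- Jensen's inequality, read off from the nonnegativity of the variance of the absolute deviation.
-/
theorem integral_abs_sub_integral_le_sqrt_variance {Ω : Type*} [MeasurableSpace Ω] {μ : Measure Ω}
    [IsProbabilityMeasure μ] {f : Ω → ℝ} (hf : MemLp f 2 μ) :
    ∫ x, |f x - ∫ y, f y ∂μ| ∂μ ≤ Real.sqrt (variance f μ) := by
  apply Real.le_sqrt_of_sq_le
  have hg : MemLp (fun x => f x - ∫ y, f y ∂μ) 2 μ := hf.sub (memLp_const _)
  have h := variance_nonneg |fun x => f x - ∫ y, f y ∂μ| μ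
  rw [variance_eq_sub hg.abs] at h
  rw [variance_eq_integral hf.1.aemeasurable]
  simpa using h

/-- For `|x| ≥ 1` each of the two pieces is at most `|x| ≤ x²`, so the Taylor bound needs no
smallness of `x`. -/
theorem norm_exp_I_mul_sub_one_sub_le (x : ℝ) :
    ‖Complex.exp (x * Complex.I) - 1 - x * Complex.I‖ ≤ 2 * x ^ 2 := by
  have hn : ‖(x : ℂ) * Complex.I‖ = |x| := by simp
  rcases le_total |x| 1 with h | h
  · have := Complex.norm_exp_sub_one_sub_id_le (x := x * Complex.I) (by rwa [hn])
    rw [hn, sq_abs] at this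
    nlinarith [sq_nonneg x]
  · have h1 : ‖Complex.exp (x * Complex.I) - 1‖ ≤ |x| := by
      simpa [mul_comm] using Real.norm_exp_I_mul_ofReal_sub_one_le (x := x)
    refine (norm_sub_le _ _).trans ?_
    rw [hn]
    nlinarith [sq_abs x]

/-! ### Counting overlapping coordinate sets. -/

section Overlaps

variable {R A : Type*} [DecidableEq R] [Fintype A]

/-- The indices whose coordinate sets meet that of `a`. -/
def overlaps (S : A → Finset R) (a : A) : Finset A := {b | ¬ Disjoint (S a) (S b)}

theorem mem_overlaps {S : A → Finset R} {a b : A} :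
    b ∈ overlaps S a ↔ ¬ Disjoint (S a) (S b) := by
  simp [overlaps]

theorem mem_overlaps_comm {S : A → Finset R} {a b : A} :
    b ∈ overlaps S a ↔ a ∈ overlaps S b := by
  rw [mem_overlaps, mem_overlaps, disjoint_comm]

variable [DecidableEq A]

/-- The pairs of indices with overlapping coordinate sets. -/
def overlapPairs (S : A → Finset R) : Finset (A × A) := {q | q.2 ∈ overlaps S q.1}

theorem sum_overlapPairs {M : Type*} [AddCommMonoid M] (S : A → Finset R) (f : A → A → M) :
    ∑ q ∈ overlapPairs S, f q.1 q.2 = ∑ a, ∑ b ∈ overlaps S a, f a b := by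
  rw [overlapPairs, Finset.sum_filter, Fintype.sum_prod_type]
  refine Finset.sum_congr rfl fun a _ => ?_
  rw [← Finset.sum_filter]
  congr 1
  ext b
  simp

theorem card_overlapPairs_le {S : A → Finset R} {D : ℕ} (hD : ∀ a, (overlaps S a).card ≤ D) :
    (overlapPairs S).card ≤ Fintype.card A * D := by
  have h := sum_overlapPairs S fun _ _ => (1 : ℕ)
  simp only [Finset.sum_const, smul_eq_mul, mul_one] at h
  rw [h]
  simpa using Finset.sum_le_card_nsmul Finset.univ _ D fun a _ => hD a

theorem card_overlapPairs_filter_le {S : A → Finset R} {D : ℕ}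
    (hD : ∀ a, (overlaps S a).card ≤ D) (a b : A) :
    {q ∈ overlapPairs S | ¬ Disjoint (S a ∪ S b) (S q.1 ∪ S q.2)}.card ≤ 4 * D ^ 2 := by
  -- One member of the pair must lie in `N`, the other among its overlaps: `2D · D` choices, doubled
  -- for the order.
  let N : Finset A := overlaps S a ∪ overlaps S b
  have hN : N.card ≤ 2 * D :=
    (Finset.card_union_le _ _).trans (by linarith [hD a, hD b])
  let P : Finset (Σ _ : A, A) := N.sigma fun c => overlaps S c
  have hP : P.card ≤ 2 * D * D := by
    rw [Finset.card_sigma]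
    refine (Finset.sum_le_card_nsmul N _ D fun c _ => hD c).trans ?_
    rw [smul_eq_mul]
    exact Nat.mul_le_mul_right _ hN
  have hsub : {q ∈ overlapPairs S | ¬ Disjoint (S a ∪ S b) (S q.1 ∪ S q.2)} ⊆
      P.image (fun s => (s.1, s.2)) ∪ P.image fun s => (s.2, s.1) := by
    rintro ⟨c, d⟩ hq
    simp only [Finset.mem_filter, overlapPairs, Finset.mem_univ, true_and,
      Finset.disjoint_union_left, Finset.disjoint_union_right] at hq
    obtain ⟨hcd, h⟩ := hq
    have hdc := mem_overlaps_comm.1 hcd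
    simp only [Finset.mem_union, Finset.mem_image, P, N, Finset.mem_sigma, Sigma.exists,
      Prod.mk.injEq]
    by_cases hc : c ∈ overlaps S a ∨ c ∈ overlaps S b
    · exact Or.inl ⟨c, d, ⟨hc, hcd⟩, rfl, rfl⟩
    · refine Or.inr ⟨d, c, ⟨?_, hdc⟩, rfl, rfl⟩
      simp only [mem_overlaps] at hc ⊢
      tauto
  calc _ ≤ _ := Finset.card_le_card hsub
    _ ≤ _ := Finset.card_union_le _ _
    _ ≤ P.card + P.card := add_le_add Finset.card_image_le Finset.card_image_le
    _ ≤ 4 * D ^ 2 := by nlinarith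

end Overlaps

/-! ### Variance bound and central limit theorem under local dependence. -/

section LocalDependence

variable {R α A : Type*} [Fintype R] [DecidableEq R] [Finite α] [MeasurableSpace α]
  [MeasurableSingletonClass α] {ν : R → Measure α} [∀ r, IsProbabilityMeasure (ν r)]

/-- Variance of a sum of bounded, locally dependent terms. -/
theorem variance_sum_le_of_dependsOn {J : Finset A} {S : A → Finset R} {Z : A → (R → α) → ℝ}
    (hZ : ∀ j ∈ J, DependsOn (Z j) (S j : Set R)) {B : ℝ} (hB : ∀ j ∈ J, ∀ x, |Z j x| ≤ B) {D : ℕ}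
    (hD : ∀ j ∈ J, {k ∈ J | ¬ Disjoint (S j) (S k)}.card ≤ D) :
    variance (fun x => ∑ j ∈ J, Z j x) (Measure.pi ν) ≤ 2 * J.card * D * B ^ 2 := by
  rw [variance_fun_sum' fun _ _ => .of_discrete]
  calc ∑ i ∈ J, ∑ j ∈ J, covariance (Z i) (Z j) (Measure.pi ν)
      ≤ ∑ i ∈ J, ∑ j ∈ J, if ¬ Disjoint (S i) (S j) then 2 * B ^ 2 else 0 := by
        refine Finset.sum_le_sum fun i hi => Finset.sum_le_sum fun j hj => ?_
        by_cases h : Disjoint (S i) (S j)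
        · simpa [h] using ((hZ i hi).covariance_pi_eq_zero (ν := ν) (hZ j hj) h).le
        · simpa [h] using covariance_le_of_abs_le (μ := Measure.pi ν) .of_discrete .of_discrete
            (hB i hi) (hB j hj)
    _ ≤ ∑ i ∈ J, D * (2 * B ^ 2) := by
        refine Finset.sum_le_sum fun i hi => ?_
        rw [← Finset.sum_filter, Finset.sum_const, nsmul_eq_mul]
        exact mul_le_mul_of_nonneg_right (mod_cast hD i hi) (by positivity)
    _ = 2 * J.card * D * B ^ 2 := by
        rw [Finset.sum_const, nsmul_eq_mul]
        ring

variable [Fintype A]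

/-- Concentration of the local quadratic form `∑_a X_a ∑_{b ∼ a} X_b`. -/
theorem variance_localQuadratic_le {S : A → Finset R} {X : A → (R → α) → ℝ}
    (hX : ∀ a, DependsOn (X a) (S a : Set R)) {B : ℝ} (hB : ∀ a x, |X a x| ≤ B) {D : ℕ}
    (hD : ∀ a, (overlaps S a).card ≤ D) :
    variance (fun x => ∑ a, ∑ b ∈ overlaps S a, X a x * X b x) (Measure.pi ν) ≤
      8 * (Fintype.card A * D ^ 3 * B ^ 4) := by
  classical
  have hsum : (fun x => ∑ a, ∑ b ∈ overlaps S a, X a x * X b x) =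
      fun x => ∑ q ∈ overlapPairs S, X q.1 x * X q.2 x := by
    funext x
    exact (sum_overlapPairs S fun a b => X a x * X b x).symm
  rw [hsum]
  -- The summands are now indexed by overlapping pairs, with coordinate sets `S a ∪ S b`: at most
  -- `|A| D` of them, each bounded by `B²` and meeting at most `4D²` others.
  refine (variance_sum_le_of_dependsOn (S := fun q : A × A => S q.1 ∪ S q.2) (B := B ^ 2)
    (D := 4 * D ^ 2) (fun q _ => ?_) (fun q _ x => ?_)
    fun q _ => card_overlapPairs_filter_le hD q.1 q.2).trans ?_
  · exact ((hX q.1).mono (by simp)).comp₂ ((hX q.2).mono (by simp)) (· * ·)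
  · rw [abs_mul, sq]
    exact mul_le_mul (hB _ x) (hB _ x) (abs_nonneg _) ((abs_nonneg _).trans (hB q.1 x))
  · have : ((overlapPairs S).card : ℝ) ≤ Fintype.card A * D := mod_cast card_overlapPairs_le hD
    push_cast
    calc 2 * ((overlapPairs S).card : ℝ) * (4 * D ^ 2) * (B ^ 2) ^ 2
        = ((overlapPairs S).card : ℝ) * (8 * D ^ 2 * B ^ 4) := by ring
      _ ≤ (Fintype.card A * D) * (8 * D ^ 2 * B ^ 4) :=
        mul_le_mul_of_nonneg_right this (by positivity)
      _ = _ := by ring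

/-- Only overlapping pairs contribute to the variance of a sum. -/
theorem variance_sum_eq_integral_localQuadratic {S : A → Finset R} {X : A → (R → α) → ℝ}
    (hX : ∀ a, DependsOn (X a) (S a : Set R)) (h0 : ∀ a, ∫ x, X a x ∂Measure.pi ν = 0) :
    variance (fun x => ∑ a, X a x) (Measure.pi ν) =
      ∫ x, ∑ a, ∑ b ∈ overlaps S a, X a x * X b x ∂Measure.pi ν := by
  rw [variance_fun_sum fun _ => .of_discrete, integral_finsetSum _ fun _ _ => .of_finite]
  refine Finset.sum_congr rfl fun a _ => ?_
  rw [integral_finsetSum _ fun _ _ => .of_finite, overlaps, Finset.sum_filter]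
  refine Finset.sum_congr rfl fun b _ => ?_
  by_cases h : Disjoint (S a) (S b)
  · simpa [h] using (hX a).covariance_pi_eq_zero (ν := ν) (hX b) h
  · rw [covariance_eq_sub .of_discrete .of_discrete, h0 a]
    simp [h]

/-- Approximate Stein identity for the characteristic function of a locally dependent sum. -/
theorem norm_integral_mul_exp_sub_le {S : A → Finset R} {X : A → (R → α) → ℝ}
    (hX : ∀ a, DependsOn (X a) (S a : Set R)) (h0 : ∀ a, ∫ x, X a x ∂Measure.pi ν = 0)
    (h1 : variance (fun x => ∑ a, X a x) (Measure.pi ν) = 1)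
    {B : ℝ} (hB : ∀ a x, |X a x| ≤ B) {D : ℕ} (hD : ∀ a, (overlaps S a).card ≤ D) (t : ℝ) :
    ‖(∫ x, ((∑ a, X a x : ℝ) : ℂ) * Complex.exp (t * (∑ a, X a x : ℝ) * Complex.I)
        ∂Measure.pi ν) - t * Complex.I *
        ∫ x, Complex.exp (t * (∑ a, X a x : ℝ) * Complex.I) ∂Measure.pi ν‖ ≤
      |t| * Real.sqrt (8 * (Fintype.card A * D ^ 3 * B ^ 4)) +
        2 * t ^ 2 * (Fintype.card A * D ^ 2 * B ^ 3) := by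
  set μ := Measure.pi ν with hμ
  set W : (R → α) → ℝ := fun x => ∑ a, X a x with hW
  set L : A → (R → α) → ℝ := fun a x => ∑ b ∈ overlaps S a, X b x with hL
  set Q : (R → α) → ℝ := fun x => ∑ a, ∑ b ∈ overlaps S a, X a x * X b x with hQ
  set e : (R → α) → ℂ := fun x => Complex.exp (t * W x * Complex.I) with he
  have hQ' : ∀ x, Q x = ∑ a, X a x * L a x := fun x => by
    simp only [hQ, hL, Finset.mul_sum]
  have hne : ∀ x, ‖e x‖ = 1 := fun x => by
    simpa [he] using Complex.norm_exp_ofReal_mul_I (t * W x)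
  have hsplit : ∀ a x, W x - L a x = ∑ b ∈ Finset.univ.filter (fun b => Disjoint (S a) (S b)),
      X b x := fun a x => by
    have := Finset.sum_filter_add_sum_filter_not Finset.univ (fun b => Disjoint (S a) (S b))
      fun b => X b x
    simp only [hW, hL, overlaps]
    linarith
  -- `W - L a` only involves terms whose sets avoid `S a`, so it is independent of the centred `X
  -- a`.
  have hvanish : ∀ a,
      ∫ x, (X a x : ℂ) * Complex.exp (t * (W x - L a x : ℝ) * Complex.I) ∂μ = 0 := by
    intro a
    have hd : DependsOn (fun x => Complex.exp (t * (W x - L a x : ℝ) * Complex.I))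
        (((S a)ᶜ : Finset R) : Set R) := by
      simp only [hsplit]
      refine DependsOn.comp_left (DependsOn.finset_sum fun b hb => (hX b).mono ?_)
        fun y : ℝ => Complex.exp (t * y * Complex.I)
      have hb' := (Finset.mem_filter.1 hb).2
      exact_mod_cast Finset.subset_compl_iff_disjoint_left.2 hb'
    rw [hμ, ((hX a).comp_left (fun y : ℝ => (y : ℂ))).integral_mul_pi hd disjoint_compl_right,
      integral_complex_ofReal, h0 a]
    simp
  have hEQ : ∫ x, Q x ∂μ = 1 := by
    rw [← h1, variance_sum_eq_integral_localQuadratic hX h0]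
  -- Expand each `exp(it(W - L_a))` around `exp(itW)`. The linear terms assemble into `it e Q`, and
  -- `Q` has mean `1`. What remains is a vanishing part, a second-order Taylor remainder and the
  -- fluctuation of `Q`.
  have hdecomp : ∀ x, (W x : ℂ) * e x - t * Complex.I * e x =
      ((∑ a, (X a x : ℂ) * Complex.exp (t * (W x - L a x : ℝ) * Complex.I)) +
        (∑ a, -((X a x : ℂ) * e x * (Complex.exp ((-(t * L a x) : ℝ) * Complex.I) - 1 -
          (-(t * L a x) : ℝ) * Complex.I)))) +
        t * Complex.I * e x * ((Q x - ∫ y, Q y ∂μ : ℝ) : ℂ) := by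
    intro x
    have hexp : ∀ a, Complex.exp (t * (W x - L a x : ℝ) * Complex.I) =
        e x * Complex.exp ((-(t * L a x) : ℝ) * Complex.I) := fun a => by
      rw [he, ← Complex.exp_add]
      congr 1
      push_cast
      ring
    have hWc : (W x : ℂ) = ∑ a, (X a x : ℂ) := by simp [hW]
    have hQc : (Q x : ℂ) = ∑ a, (X a x : ℂ) * L a x := by
      rw [hQ' x]; push_cast; rfl
    rw [← Finset.sum_add_distrib, hEQ, Complex.ofReal_sub, Complex.ofReal_one, hWc, hQc,
      mul_sub, Finset.mul_sum, Finset.sum_mul]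
    have : ∀ a, (X a x : ℂ) * e x =
        ((X a x : ℂ) * Complex.exp (t * (W x - L a x : ℝ) * Complex.I) +
        -((X a x : ℂ) * e x * (Complex.exp ((-(t * L a x) : ℝ) * Complex.I) - 1 -
          (-(t * L a x) : ℝ) * Complex.I))) + t * Complex.I * e x * ((X a x : ℂ) * L a x) := by
      intro a
      rw [hexp a]
      push_cast
      ring
    rw [Finset.sum_congr rfl fun a _ => this a, Finset.sum_add_distrib, mul_one, add_sub_assoc]
  have hLB : ∀ a x, |L a x| ≤ D * B := fun a x => by
    have hB0 : 0 ≤ B := (abs_nonneg _).trans (hB a x)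
    calc |L a x| ≤ ∑ b ∈ overlaps S a, |X b x| := Finset.abs_sum_le_sum_abs _ _
      _ ≤ (overlaps S a).card • B := Finset.sum_le_card_nsmul _ _ _ fun b _ => hB b x
      _ ≤ D * B := by
        rw [nsmul_eq_mul]
        exact mul_le_mul_of_nonneg_right (mod_cast hD a) hB0
  have herr : ‖∫ x, ∑ a, -((X a x : ℂ) * e x * (Complex.exp ((-(t * L a x) : ℝ) * Complex.I) - 1 -
      (-(t * L a x) : ℝ) * Complex.I)) ∂μ‖ ≤ 2 * t ^ 2 * (Fintype.card A * D ^ 2 * B ^ 3) := by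
    have hpt : ∀ x, ‖∑ a, -((X a x : ℂ) * e x * (Complex.exp ((-(t * L a x) : ℝ) * Complex.I) - 1 -
      (-(t * L a x) : ℝ) * Complex.I))‖ ≤ 2 * t ^ 2 * (Fintype.card A * D ^ 2 * B ^ 3) := by
      intro x
      calc _ ≤ ∑ _a : A, B * (2 * (t ^ 2 * (D * B) ^ 2)) := by
            refine (norm_sum_le _ _).trans (Finset.sum_le_sum fun a _ => ?_)
            rw [norm_neg, norm_mul, norm_mul, hne, mul_one, Complex.norm_real, Real.norm_eq_abs]
            refine mul_le_mul (hB a x) ((norm_exp_I_mul_sub_one_sub_le _).trans ?_)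
              (norm_nonneg _) ((abs_nonneg _).trans (hB a x))
            rw [neg_sq, mul_pow]
            have := sq_le_sq' (neg_le_of_abs_le (hLB a x)) (le_of_abs_le (hLB a x))
            gcongr
        _ = _ := by
            simp only [Finset.sum_const, Finset.card_univ, nsmul_eq_mul]
            ring
    simpa using norm_integral_le_of_norm_le_const (μ := μ) (.of_forall hpt)
  have hquad : ‖∫ x, t * Complex.I * e x * ((Q x - ∫ y, Q y ∂μ : ℝ) : ℂ) ∂μ‖ ≤
      |t| * Real.sqrt (8 * (Fintype.card A * D ^ 3 * B ^ 4)) := by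
    refine (norm_integral_le_integral_norm _).trans ?_
    have : ∀ x, ‖t * Complex.I * e x * ((Q x - ∫ y, Q y ∂μ : ℝ) : ℂ)‖ =
        |t| * |Q x - ∫ y, Q y ∂μ| := fun x => by
      rw [norm_mul, norm_mul, norm_mul, hne, Complex.norm_real, Complex.norm_real]
      simp
    simp only [this]
    rw [integral_const_mul]
    exact mul_le_mul_of_nonneg_left ((integral_abs_sub_integral_le_sqrt_variance .of_discrete).trans
      (Real.sqrt_le_sqrt (variance_localQuadratic_le hX hB hD))) (abs_nonneg t)
  rw [← integral_const_mul, ← integral_sub .of_finite .of_finite]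
  rw [integral_congr_ae (.of_forall hdecomp), integral_add .of_finite .of_finite,
    integral_add .of_finite .of_finite, integral_finsetSum _ fun _ _ => .of_finite,
    Finset.sum_congr rfl fun a _ => hvanish a, Finset.sum_const_zero, zero_add]
  refine (norm_add_le _ _).trans ?_
  linarith

/-- Quantitative central limit theorem for locally dependent sums, on characteristic functions. -/
theorem norm_charFun_sub_gaussian_le {S : A → Finset R} {X : A → (R → α) → ℝ}
    (hX : ∀ a, DependsOn (X a) (S a : Set R)) (h0 : ∀ a, ∫ x, X a x ∂Measure.pi ν = 0)
    (h1 : variance (fun x => ∑ a, X a x) (Measure.pi ν) = 1)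
    {B : ℝ} (hB : ∀ a x, |X a x| ≤ B) {D : ℕ} (hD : ∀ a, (overlaps S a).card ≤ D) (t : ℝ) :
    ‖charFun ((Measure.pi ν).map fun x => ∑ a, X a x) t - Complex.exp (-(t ^ 2 / 2))‖ ≤
      |t| * (|t| * Real.sqrt (8 * (Fintype.card A * D ^ 3 * B ^ 4)) +
        2 * t ^ 2 * |Fintype.card A * D ^ 2 * B ^ 3|) := by
  have := Fintype.ofFinite (R → α)
  set μ := Measure.pi ν with hμ
  set W : (R → α) → ℝ := fun x => ∑ a, X a x with hW
  set φ : ℝ → ℂ := fun s => ∫ x, Complex.exp (s * W x * Complex.I) ∂μ with hφ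
  set φ' : ℝ → ℂ := fun s => Complex.I * ∫ x, (W x : ℂ) * Complex.exp (s * W x * Complex.I) ∂μ
    with hφ'
  -- The space is finite, so the integral is a finite sum and can be differentiated termwise.
  have hder : ∀ s, HasDerivAt φ (φ' s) s := by
    intro s
    have h : ∀ x, HasDerivAt (fun s : ℝ => Complex.exp (s * W x * Complex.I))
        (Complex.exp (s * W x * Complex.I) * (1 * W x * Complex.I)) s := fun x =>
      (((Complex.ofRealCLM.hasDerivAt (x := s)).mul_const (W x : ℂ)).mul_const Complex.I).cexp
    have hs : HasDerivAt (fun s : ℝ => ∑ x, μ.real {x} • Complex.exp (s * W x * Complex.I))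
        (∑ x, μ.real {x} • (Complex.exp (s * W x * Complex.I) * (1 * W x * Complex.I))) s :=
      HasDerivAt.fun_sum fun x _ => (h x).fun_const_smul _
    convert hs using 1
    · funext s
      exact integral_fintype .of_finite
    · simp only [hφ']
      rw [integral_fintype .of_finite, Finset.mul_sum]
      refine Finset.sum_congr rfl fun x _ => ?_
      simp only [Complex.real_smul]
      ring
  -- The absolute value makes the bound nonnegative and monotone in `|t|` without a proof of `0 ≤
  -- B`.
  set ε := |t| * Real.sqrt (8 * (Fintype.card A * D ^ 3 * B ^ 4)) +
        2 * t ^ 2 * |Fintype.card A * D ^ 2 * B ^ 3| with hε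
  have hg : ∀ s : ℝ, HasDerivAt (fun s : ℝ => Complex.exp ((s : ℂ) ^ 2 / 2))
      (Complex.exp ((s : ℂ) ^ 2 / 2) * s) s := fun s => by
    have h := (((Complex.ofRealCLM.hasDerivAt (x := s)).fun_pow 2).div_const 2).cexp
    exact h.congr_deriv (by simp)
  have hprod : ∀ s : ℝ, HasDerivAt (fun s : ℝ => φ s * Complex.exp ((s : ℂ) ^ 2 / 2))
      (φ' s * Complex.exp ((s : ℂ) ^ 2 / 2) + φ s * (Complex.exp ((s : ℂ) ^ 2 / 2) * s)) s :=
    fun s => (hder s).mul (hg s)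
  have hnexp : ∀ s : ℝ, ‖Complex.exp ((s : ℂ) ^ 2 / 2)‖ = Real.exp (s ^ 2 / 2) := fun s => by
    rw [Complex.norm_exp]
    congr 1
    norm_cast
  have hbound : ∀ s ∈ Set.uIcc 0 t, ‖φ' s * Complex.exp ((s : ℂ) ^ 2 / 2) +
      φ s * (Complex.exp ((s : ℂ) ^ 2 / 2) * s)‖ ≤ ε * Real.exp (t ^ 2 / 2) := by
    intro s hs
    have hst : |s| ≤ |t| := by simpa using Set.abs_sub_left_of_mem_uIcc hs
    have hst2 : s ^ 2 ≤ t ^ 2 := sq_le_sq.2 hst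
    have heq : φ' s * Complex.exp ((s : ℂ) ^ 2 / 2) + φ s * (Complex.exp ((s : ℂ) ^ 2 / 2) * s) =
        Complex.I * ((∫ x, (W x : ℂ) * Complex.exp (s * W x * Complex.I) ∂μ) -
          s * Complex.I * φ s) * Complex.exp ((s : ℂ) ^ 2 / 2) := by
      rw [hφ']
      linear_combination (φ s * Complex.exp ((s : ℂ) ^ 2 / 2) * s) * Complex.I_sq
    rw [heq, norm_mul, norm_mul, Complex.norm_I, one_mul, hnexp]
    refine mul_le_mul ((norm_integral_mul_exp_sub_le hX h0 h1 hB hD s).trans ?_)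
      (Real.exp_le_exp.2 (by linarith)) (Real.exp_pos _).le (by positivity)
    rw [hε]
    refine add_le_add (mul_le_mul_of_nonneg_right hst (Real.sqrt_nonneg _)) ?_
    exact (mul_le_mul_of_nonneg_left (le_abs_self _) (by positivity)).trans
      (mul_le_mul_of_nonneg_right (by linarith) (abs_nonneg _))
  -- The mean value inequality for `φ(s) exp(s²/2)`, which equals `1` at `s = 0`; the factor
  -- `exp(t²/2)` cancels at the end.
  have hmv := (convex_uIcc (0 : ℝ) t).norm_image_sub_le_of_norm_hasDerivWithin_le
    (fun s _ => (hprod s).hasDerivWithinAt) hbound Set.left_mem_uIcc Set.right_mem_uIcc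
  have hφ0 : φ 0 = 1 := by simp [hφ]
  have hchar : charFun (μ.map W) t = φ t := by
    rw [charFun_apply_real, integral_map (Measurable.of_discrete).aemeasurable (by fun_prop)]
  have hpos := Real.exp_pos (t ^ 2 / 2)
  have hone : Complex.exp (-((t : ℂ) ^ 2 / 2)) * Complex.exp ((t : ℂ) ^ 2 / 2) = 1 := by
    rw [← Complex.exp_add]; simp
  have hfin : ‖φ t - Complex.exp (-((t : ℂ) ^ 2 / 2))‖ * Real.exp (t ^ 2 / 2) ≤
      |t| * ε * Real.exp (t ^ 2 / 2) := by
    rw [← hnexp, ← norm_mul, sub_mul, hone, hnexp]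
    calc _ ≤ _ := by simpa [hφ0] using hmv
      _ = _ := by ring
  rw [hchar]
  exact le_of_mul_le_mul_right hfin hpos

end LocalDependence

/-! ### A single analysis unit: locality, bounds and unbiasedness. -/

@[simp]
theorem bitVal_true : bitVal true = 1 := rfl

@[simp]
theorem bitVal_false : bitVal false = 0 := rfl

theorem bitVal_mul_self (b : Bool) : bitVal b * bitVal b = bitVal b := by
  cases b <;> simp

theorem dependsOn_sum_bitVal_mul {R : Type*} (s : Finset R) (v : R → ℝ) :
    DependsOn (fun T : R → Bool => ∑ r ∈ s, bitVal (T r) * v r) (s : Set R) :=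
  DependsOn.finset_sum fun r hr _ _ h => by rw [h r hr]

namespace BipartiteExperiment

noncomputable section

section SingleUnit

variable {A R : Type*} [Fintype R] {X : BipartiteExperiment A R}

theorem mem_unitsOf {a : A} {r : R} :
    r ∈ X.unitsOf a ↔ X.E a r (fun _ => true) = true := by
  simp [unitsOf]

theorem IsAnchor.mem_unitsOf (h : X.IsAnchor) {a : A} {r : R} (har : (a, r) ∈ X.G) :
    r ∈ X.unitsOf a :=
  BipartiteExperiment.mem_unitsOf.2 (h a r har _)

theorem BasicAssumptions.mem_unitsOf (h : X.BasicAssumptions) {a : A} {r : R}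
    (hu : X.u a r ≠ 0) : r ∈ X.unitsOf a :=
  h.anchor.mem_unitsOf (h.u_support a r hu)

/-- Under `r`-driven edges, a treated unit is connected exactly if it lies in `R_a`. -/
theorem RDriven.bitVal_mul_bitVal (h : X.RDriven) (a : A) (r : R) (T : R → Bool) :
    bitVal (T r) * bitVal (X.E a r T) =
      (X.unitsOf a : Set R).indicator (fun r => bitVal (T r)) r := by
  cases hT : T r
  · simp [Set.indicator, hT]
  · have hE := h a r T (fun _ => true) hT
    by_cases hr : r ∈ X.unitsOf a
    · simp [hr, hT, hE, BipartiteExperiment.mem_unitsOf.1 hr]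
    · have : X.E a r (fun _ => true) = false := by simpa [BipartiteExperiment.mem_unitsOf] using hr
      simp [hr, hE, this]

theorem exposure_eq (h : X.RDriven) (a : A) (T : R → Bool) :
    X.exposure a T = ∑ r ∈ X.unitsOf a, bitVal (T r) * X.w a r := by
  classical
  simp only [exposure, h.bitVal_mul_bitVal, Set.indicator_apply, ite_mul, zero_mul,
    Finset.mem_coe, Finset.sum_ite_mem, Finset.univ_inter]

theorem weightHat_eq (h : X.BasicAssumptions) (a : A) (T : R → Bool) :
    X.weightHat a T = ∑ r ∈ X.unitsOf a,
      (bitVal (T r) * X.w a r * (1 - X.c a r) / (X.p : ℝ) + X.w a r * X.c a r) := by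
  classical
  have hterm : ∀ r, bitVal (T r) * X.w a r * (bitVal (X.E a r T) - X.c a r) =
      X.w a r * (bitVal (T r) * bitVal (X.E a r T)) - bitVal (T r) * X.w a r * X.c a r :=
    fun r => by ring
  rw [weightHat]
  symm
  refine Finset.sum_subset_zero_on_sdiff (Finset.subset_univ _) (fun r hr => ?_) fun r hr => ?_
  · have hr' : r ∉ X.unitsOf a := (Finset.mem_sdiff.1 hr).2
    have hc : X.c a r = 0 := by
      rw [h.c_eq, Set.indicator_of_notMem fun hG => hr' (h.anchor.mem_unitsOf hG)]
    rw [hterm, h.rDriven.bitVal_mul_bitVal]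
    simp [hr', hc]
  · rw [hterm, h.rDriven.bitVal_mul_bitVal]
    simp only [Finset.mem_coe, hr, Set.indicator_of_mem]
    ring

theorem integral_bitVal (r : R) : ∫ T, bitVal (T r) ∂X.law = X.p := by
  unfold law
  rw [integral_comp_eval (μ := fun _ : R => bernoulliMeasure true false X.p) (f := bitVal)
    .of_discrete, integral_bernoulliMeasure]
  simp

theorem covariance_bitVal [DecidableEq R] (r r' : R) :
    covariance (fun T : R → Bool => bitVal (T r)) (fun T => bitVal (T r')) X.law =
      if r = r' then (X.p : ℝ) * (1 - X.p) else 0 := by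
  split_ifs with h
  · subst h
    rw [covariance_eq_sub .of_discrete .of_discrete]
    simp only [Pi.mul_apply, bitVal_mul_self, integral_bitVal]
    ring
  · refine DependsOn.covariance_pi_eq_zero (s := {r}) (t := {r'}) ?_ ?_ (by simpa using h)
    · exact fun x y hxy => congrArg bitVal (hxy r (by simp))
    · exact fun x y hxy => congrArg bitVal (hxy r' (by simp))

theorem integral_sum_bitVal_mul (s : Finset R) (v : R → ℝ) :
    ∫ T, ∑ r ∈ s, bitVal (T r) * v r ∂X.law = X.p * ∑ r ∈ s, v r := by
  rw [integral_finsetSum _ fun _ _ => .of_finite, Finset.mul_sum]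
  simp only [integral_mul_const, integral_bitVal]

theorem covariance_exposure_instrument (h : X.BasicAssumptions) (a : A) :
    covariance (X.exposure a) (X.instrument a) X.law =
      X.p * (1 - X.p) * ∑ r, X.w a r * X.u a r := by
  classical
  have hx : X.exposure a = fun T => ∑ r ∈ X.unitsOf a, bitVal (T r) * X.w a r :=
    funext (exposure_eq h.rDriven a)
  have hz : X.instrument a = fun T => ∑ r, bitVal (T r) * X.u a r := rfl
  rw [hx, hz, covariance_fun_sum_fun_sum' (fun _ _ => .of_discrete) fun _ _ => .of_discrete]
  simp only [covariance_mul_const_left, covariance_mul_const_right, covariance_bitVal, ite_mul,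
    zero_mul, Finset.sum_ite_eq, Finset.mem_univ, if_true]
  rw [Finset.mul_sum]
  refine Finset.sum_subset_zero_on_sdiff (Finset.subset_univ _) (fun r hr => ?_) fun r _ => by ring
  have hu : X.u a r = 0 := by
    by_contra hu
    exact (Finset.mem_sdiff.1 hr).2 (h.mem_unitsOf hu)
  simp [hu]

theorem dependsOn_instrument {a : A} {s : Set R} (hs : ∀ r, X.u a r ≠ 0 → r ∈ s) :
    DependsOn (X.instrument a) s := by
  refine DependsOn.finset_sum fun r _ T T' h => ?_
  by_cases hu : X.u a r = 0
  · simp [hu]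
  · rw [h r (hs r hu)]

/-- The source of local dependence. Edges to untreated units outside `R_a` may exist, but the linear
model lets the outcome see only the exposure. -/
theorem dependsOn_betaHat_mul_weightHat (h : X.BasicAssumptions) (a : A) :
    DependsOn (fun T => X.betaHat a T * X.weightHat a T) (X.unitsOf a : Set R) := by
  obtain ⟨α, β, hY⟩ := h.linear
  intro T T' hT
  have hx : X.exposure a T = X.exposure a T' := by
    rw [exposure_eq h.rDriven, exposure_eq h.rDriven]
    exact dependsOn_sum_bitVal_mul _ _ hT
  have hz : X.instrument a T = X.instrument a T' :=
    dependsOn_instrument (fun r hu => h.mem_unitsOf hu) hT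
  have hw : X.weightHat a T = X.weightHat a T' := by
    rw [weightHat_eq h, weightHat_eq h]
    exact Finset.sum_congr rfl fun r hr => by rw [hT r hr]
  simp only [betaHat, hY, hx, hz, hw]

/-- Multiplying by the single weight `w r₀` makes every nonzero term positive, so nothing cancels.
-/
theorem abs_sum_mul_eq_of_sameSign {w u : R → ℝ} (hu : ∀ r, 0 ≤ u r)
    (hs : ∀ r r', u r ≠ 0 → u r' ≠ 0 → 0 < w r * w r') {r₀ : R} (hr₀ : u r₀ ≠ 0) :
    |∑ r, w r * u r| = ∑ r, |w r| * u r := by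
  have hw₀ : 0 < |w r₀| := abs_pos.2 fun h => by simpa [h] using hs r₀ r₀ hr₀ hr₀
  have key : (∑ r, w r * u r) * w r₀ = (∑ r, |w r| * u r) * |w r₀| := by
    rw [Finset.sum_mul, Finset.sum_mul]
    refine Finset.sum_congr rfl fun r _ => ?_
    by_cases hur : u r = 0
    · simp [hur]
    · have := abs_of_pos (hs r r₀ hur hr₀)
      rw [abs_mul] at this
      linear_combination (-u r) * this
  have hnn : 0 ≤ ∑ r, |w r| * u r :=
    Finset.sum_nonneg fun r _ => mul_nonneg (abs_nonneg _) (hu r)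
  have := congrArg abs key
  rw [abs_mul, abs_mul, abs_abs, abs_of_nonneg hnn] at this
  exact mul_right_cancel₀ hw₀.ne' this

theorem covariance_exposure_instrument_ge {δ Wl Wh M : ℝ} (hδ : 0 < δ) (hWl : 0 < Wl)
    (h : X.AsymptoticAssumptions δ Wl Wh M) (a : A) :
    δ ^ 2 * (Wl / (X.unitsOf a).card) * ∑ r, X.u a r ≤
      |covariance (X.exposure a) (X.instrument a) X.law| := by
  obtain ⟨r₀, hr₀⟩ := h.u_nontrivial a
  rw [covariance_exposure_instrument h.toBasicAssumptions, abs_mul,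
    abs_sum_mul_eq_of_sameSign (h.u_nonneg a) (h.same_sign a) hr₀, mul_assoc]
  have hp : δ ^ 2 ≤ |(X.p : ℝ) * (1 - X.p)| := by
    refine le_trans ?_ (le_abs_self _)
    rw [sq]
    exact mul_le_mul h.p_lower h.p_upper hδ.le h.p_pos.le
  refine mul_le_mul hp ?_ (mul_nonneg (by positivity)
    (Finset.sum_nonneg fun r _ => h.u_nonneg a r)) (abs_nonneg _)
  rw [Finset.mul_sum]
  refine Finset.sum_le_sum fun r _ => ?_
  by_cases hu : X.u a r = 0
  · simp [hu]
  · exact mul_le_mul_of_nonneg_right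
      (h.w_lower a r (h.toBasicAssumptions.mem_unitsOf hu)) (h.u_nonneg a r)

theorem card_unitsOf_pos (h : X.BasicAssumptions) (a : A) : 0 < (X.unitsOf a).card := by
  obtain ⟨r, hr⟩ := h.u_nontrivial a
  exact Finset.card_pos.2 ⟨r, h.mem_unitsOf hr⟩

theorem covariance_exposure_instrument_ne_zero {δ Wl Wh M : ℝ} (hδ : 0 < δ) (hWl : 0 < Wl)
    (h : X.AsymptoticAssumptions δ Wl Wh M) (a : A) :
    covariance (X.exposure a) (X.instrument a) X.law ≠ 0 := by
  obtain ⟨r₀, hr₀⟩ := h.u_nontrivial a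
  have hU : 0 < ∑ r, X.u a r :=
    Finset.sum_pos' (fun r _ => h.u_nonneg a r)
      ⟨r₀, Finset.mem_univ _, lt_of_le_of_ne (h.u_nonneg a r₀) hr₀.symm⟩
  have hm : (0 : ℝ) < (X.unitsOf a).card := mod_cast card_unitsOf_pos h.toBasicAssumptions a
  have hlow : 0 < δ ^ 2 * (Wl / (X.unitsOf a).card) * ∑ r, X.u a r := by positivity
  exact abs_pos.1 (hlow.trans_le (covariance_exposure_instrument_ge hδ hWl h a))

theorem abs_instrument_sub_le (h : ∀ a r, 0 ≤ X.u a r) (a : A) (T : R → Bool) :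
    |X.instrument a T - ∫ T', X.instrument a T' ∂X.law| ≤ ∑ r, X.u a r := by
  simp only [instrument]
  rw [integral_sum_bitVal_mul, Finset.mul_sum, ← Finset.sum_sub_distrib]
  refine (Finset.abs_sum_le_sum_abs _ _).trans (Finset.sum_le_sum fun r _ => ?_)
  rw [← sub_mul, abs_mul, abs_of_nonneg (h a r)]
  refine mul_le_of_le_one_left (h a r) ?_
  have h0 := X.p.2.1
  have h1 := X.p.2.2
  cases T r
  · simpa [abs_of_nonneg h0] using h1
  · rw [bitVal_true, abs_of_nonneg (by linarith)]
    linarith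

/-- The total instrument weight `∑ r, u a r` bounds the centred instrument and also appears in the
lower bound on the covariance, so it cancels; the price is a factor `|R_a|`. -/
theorem abs_betaHat_le {δ Wl Wh M : ℝ} (hδ : 0 < δ) (hWl : 0 < Wl)
    (h : X.AsymptoticAssumptions δ Wl Wh M) (a : A) (T : R → Bool) :
    |X.betaHat a T| ≤ M / (δ ^ 2 * Wl) * (X.unitsOf a).card := by
  obtain ⟨r₀, hr₀⟩ := h.u_nontrivial a
  have hU : 0 < ∑ r, X.u a r :=
    Finset.sum_pos' (fun r _ => h.u_nonneg a r)
      ⟨r₀, Finset.mem_univ _, lt_of_le_of_ne (h.u_nonneg a r₀) hr₀.symm⟩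
  have hm : (0 : ℝ) < (X.unitsOf a).card := mod_cast card_unitsOf_pos h.toBasicAssumptions a
  have hcov := covariance_exposure_instrument_ge hδ hWl h a
  have hlow : 0 < δ ^ 2 * (Wl / (X.unitsOf a).card) * ∑ r, X.u a r := by positivity
  rw [betaHat, abs_div, abs_mul]
  calc _ ≤ M * (∑ r, X.u a r) / (δ ^ 2 * (Wl / (X.unitsOf a).card) * ∑ r, X.u a r) := by
        have hM : 0 ≤ M := (abs_nonneg _).trans (h.bounded a T)
        exact div_le_div₀ (by positivity) (mul_le_mul (h.bounded a T)
          (abs_instrument_sub_le h.u_nonneg a T) (abs_nonneg _) hM) hlow hcov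
    _ = _ := by field_simp

theorem abs_weightHat_le {δ Wl Wh M : ℝ} (hδ : 0 < δ) (hWh : 0 < Wh)
    (h : X.AsymptoticAssumptions δ Wl Wh M) (a : A) (T : R → Bool) :
    |X.weightHat a T| ≤ Wh / δ := by
  have hm : (0 : ℝ) < (X.unitsOf a).card := mod_cast card_unitsOf_pos h.toBasicAssumptions a
  have hp := h.p_pos
  rw [weightHat_eq h.toBasicAssumptions]
  have hterm : ∀ r ∈ X.unitsOf a,
      |bitVal (T r) * X.w a r * (1 - X.c a r) / (X.p : ℝ) + X.w a r * X.c a r| ≤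
        Wh / (X.unitsOf a).card / δ := by
    intro r hr
    -- This factor is `1` at an anchor and `0` or `1 / p` elsewhere.
    have hb : |bitVal (T r) * (1 - X.c a r) / (X.p : ℝ) + X.c a r| ≤ 1 / δ := by
      have hp1 : 1 / (X.p : ℝ) ≤ 1 / δ := one_div_le_one_div_of_le hδ h.p_lower
      have h1 : 1 ≤ 1 / (X.p : ℝ) := (one_le_div hp).2 h.p_lt_one.le
      have hc : X.c a r = 1 ∨ X.c a r = 0 := by
        rw [h.c_eq]
        by_cases hG : (a, r) ∈ X.G <;> simp [hG]
      rcases hc with hc | hc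
      · rw [hc]
        simpa using h1.trans hp1
      · rw [hc]
        cases T r
        · simpa using hδ.le
        · rw [bitVal_true, sub_zero, mul_one, add_zero, abs_of_pos (by positivity)]
          exact hp1
    have heq : bitVal (T r) * X.w a r * (1 - X.c a r) / (X.p : ℝ) + X.w a r * X.c a r =
        X.w a r * (bitVal (T r) * (1 - X.c a r) / (X.p : ℝ) + X.c a r) := by ring
    rw [heq, abs_mul, div_eq_mul_one_div _ δ]
    exact mul_le_mul (h.w_upper a r hr) hb (abs_nonneg _) (by positivity)
  refine (Finset.abs_sum_le_sum_abs _ _).trans ((Finset.sum_le_card_nsmul _ _ _ hterm).trans ?_)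
  rw [nsmul_eq_mul]
  exact le_of_eq (by field_simp)

/-- Each summand of the estimator is unbiased for the effect on its analysis unit. -/
theorem integral_betaHat_mul_weightHat (h : X.BasicAssumptions) (a : A)
    (hcov : covariance (X.exposure a) (X.instrument a) X.law ≠ 0) :
    ∫ T, X.betaHat a T * X.weightHat a T ∂X.law =
      X.Y a (fun _ => true) - X.Y a (fun _ => false) := by
  classical
  obtain ⟨α, β, hY⟩ := h.linear
  have hp := h.p_pos.ne'
  set C := covariance (X.exposure a) (X.instrument a) X.law with hC
  -- Anchors `P` carry the instrument; non-anchors `N` carry the randomness of `weightHat`.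
  let P : Finset R := {r ∈ X.unitsOf a | (a, r) ∈ X.G}
  let N : Finset R := {r ∈ X.unitsOf a | (a, r) ∉ X.G}
  have hPN : Disjoint P N := Finset.disjoint_filter_filter_not _ _ _
  let xP : (R → Bool) → ℝ := fun T => ∑ r ∈ P, bitVal (T r) * X.w a r
  let xN : (R → Bool) → ℝ := fun T => ∑ r ∈ N, bitVal (T r) * X.w a r
  let wP : ℝ := ∑ r ∈ P, X.w a r
  let wN : ℝ := ∑ r ∈ N, X.w a r
  let g : (R → Bool) → ℝ := fun T => X.instrument a T - ∫ T', X.instrument a T' ∂X.law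
  have hexp : ∀ T, X.exposure a T = xP T + xN T := fun T => by
    rw [exposure_eq h.rDriven]
    exact (Finset.sum_filter_add_sum_filter_not _ _ _).symm
  have hwt : ∀ T, X.weightHat a T = wP + xN T / X.p := fun T => by
    rw [weightHat_eq h, ← Finset.sum_filter_add_sum_filter_not _ fun r => (a, r) ∈ X.G]
    congr 1
    · refine Finset.sum_congr rfl fun r hr => ?_
      have hc : X.c a r = 1 := by rw [h.c_eq, Set.indicator_of_mem (Finset.mem_filter.1 hr).2]
      simp [hc]
    · rw [Finset.sum_div]
      refine Finset.sum_congr rfl fun r hr => ?_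
      have hc : X.c a r = 0 := by rw [h.c_eq, Set.indicator_of_notMem (Finset.mem_filter.1 hr).2]
      simp [hc]
  have hxP : DependsOn xP (P : Set R) := dependsOn_sum_bitVal_mul _ _
  have hxN : DependsOn xN (N : Set R) := dependsOn_sum_bitVal_mul _ _
  have hz : DependsOn (X.instrument a) (P : Set R) := dependsOn_instrument fun r hu =>
    Finset.mem_coe.2 (Finset.mem_filter.2 ⟨h.mem_unitsOf hu, h.u_support a r hu⟩)
  have hg : DependsOn g (P : Set R) := hz.comp_left (· - ∫ T', X.instrument a T' ∂X.law)
  have hCP : C = covariance xP (X.instrument a) X.law := by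
    have : X.exposure a = xP + xN := funext hexp
    rw [hC, this, covariance_add_left .of_discrete .of_discrete .of_discrete]
    have h0 : covariance xN (X.instrument a) X.law = 0 :=
      hxN.covariance_pi_eq_zero hz hPN.symm
    rw [h0, add_zero]
  have hg0 : ∫ T, g T ∂X.law = 0 := by
    simp only [g]
    rw [integral_sub .of_finite .of_finite]
    simp
  have hgx : ∫ T, g T * xP T ∂X.law = C := by
    rw [hCP, covariance_eq_sub .of_discrete .of_discrete]
    simp only [g, sub_mul]
    rw [integral_sub .of_finite .of_finite, integral_const_mul]
    simp only [Pi.mul_apply, mul_comm]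
  have hlin : ∫ T, g T * (α a + β a * xP T) ∂X.law = β a * C := by
    have : ∀ T, g T * (α a + β a * xP T) = α a * g T + β a * (g T * xP T) := fun T => by ring
    simp only [this]
    rw [integral_add .of_finite .of_finite, integral_const_mul, integral_const_mul, hg0, hgx]
    ring
  have hwE : ∫ T, (wP + xN T / X.p) ∂X.law = wP + wN := by
    rw [integral_add .of_finite .of_finite, integral_div, integral_sum_bitVal_mul,
      mul_div_cancel_left₀ _ hp]
    simp [wN]
  have hw : DependsOn (fun T => wP + xN T / X.p) (N : Set R) :=
    hxN.comp_left fun y => wP + y / X.p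
  -- In the first product the outcome is restricted to anchors, so it is independent of `weightHat`.
  -- In the second the centred instrument `g` is independent of everything else and gives mean zero.
  have hpt : ∀ T, X.betaHat a T * X.weightHat a T =
      C⁻¹ * (g T * (α a + β a * xP T) * (wP + xN T / X.p) +
        g T * (β a * xN T * (wP + xN T / X.p))) := fun T => by
    rw [hwt, betaHat, hY, hexp]
    change _ * g T / C * _ = _
    ring
  have hI1 : ∫ T, g T * (α a + β a * xP T) * (wP + xN T / X.p) ∂X.law =
      (∫ T, g T * (α a + β a * xP T) ∂X.law) * ∫ T, (wP + xN T / X.p) ∂X.law :=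
    (hg.comp₂ hxP fun y z => y * (α a + β a * z)).integral_mul_pi hw hPN
  have hI2 : ∫ T, g T * (β a * xN T * (wP + xN T / X.p)) ∂X.law =
      (∫ T, g T ∂X.law) * ∫ T, β a * xN T * (wP + xN T / X.p) ∂X.law :=
    hg.integral_mul_pi (hxN.comp_left fun y => β a * y * (wP + y / X.p)) hPN
  simp only [hpt]
  rw [integral_const_mul, integral_add .of_finite .of_finite, hI1, hI2, hlin, hwE, hg0, hY, hY,
    hexp, hexp]
  have hone : xP (fun _ => true) + xN (fun _ => true) = wP + wN := by simp [xP, xN, wP, wN]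
  have hzero : xP (fun _ => false) + xN (fun _ => false) = 0 := by simp [xP, xN]
  rw [hone, hzero]
  field_simp
  ring

end SingleUnit

/-! ### The averaged estimator: variance, concentration and normality. -/

section Aggregate

variable {A R : Type*} [Fintype A] [Fintype R] {X : BipartiteExperiment A R}

/-- The estimator of the total treatment effect is unbiased. -/
theorem integral_muHat {δ Wl Wh M : ℝ} (hδ : 0 < δ) (hWl : 0 < Wl)
    (h : X.AsymptoticAssumptions δ Wl Wh M) : ∫ T, X.muHat T ∂X.law = X.tte := by
  simp only [muHat, tte]
  rw [integral_const_mul, integral_finsetSum _ fun _ _ => .of_finite]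
  congr 1
  exact Finset.sum_congr rfl fun a _ => integral_betaHat_mul_weightHat h.toBasicAssumptions a
    (covariance_exposure_instrument_ne_zero hδ hWl h a)

theorem abs_betaHat_mul_weightHat_le {δ Wl Wh M : ℝ} (hδ : 0 < δ) (hWl : 0 < Wl) (hWh : 0 < Wh)
    (hM : 0 < M) (h : X.AsymptoticAssumptions δ Wl Wh M) (a : A) (T : R → Bool) :
    |X.betaHat a T * X.weightHat a T| ≤ M * Wh / (δ ^ 3 * Wl) * X.degA := by
  have hd : ((X.unitsOf a).card : ℝ) ≤ X.degA := by
    exact_mod_cast Finset.le_sup (f := fun a => (X.unitsOf a).card) (Finset.mem_univ a)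
  rw [abs_mul]
  calc |X.betaHat a T| * |X.weightHat a T|
      ≤ M / (δ ^ 2 * Wl) * (X.unitsOf a).card * (Wh / δ) :=
        mul_le_mul (abs_betaHat_le hδ hWl h a T) (abs_weightHat_le hδ hWh h a T) (abs_nonneg _)
          (by positivity)
    _ = M * Wh / (δ ^ 3 * Wl) * (X.unitsOf a).card := by field_simp
    _ ≤ _ := by gcongr

/-- An overlapping index shares some `r ∈ R_a`, hence lies in `A_r`; a union bound over `R_a`
follows. -/
theorem card_overlaps_unitsOf_le [DecidableEq R] (a : A) :
    (overlaps X.unitsOf a).card ≤ X.degA * X.degR := by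
  classical
  have hsub : overlaps X.unitsOf a ⊆ (X.unitsOf a).biUnion X.analysisOf := by
    intro b hb
    obtain ⟨r, hra, hrb⟩ := Finset.not_disjoint_iff.1 (mem_overlaps.1 hb)
    refine Finset.mem_biUnion.2 ⟨r, hra, ?_⟩
    simpa [analysisOf] using mem_unitsOf.1 hrb
  refine (Finset.card_le_card hsub).trans ((Finset.card_biUnion_le_card_mul _ _ X.degR
    fun r _ => Finset.le_sup (f := fun r => (X.analysisOf r).card) (Finset.mem_univ r)).trans ?_)
  exact Nat.mul_le_mul_right _
    (Finset.le_sup (f := fun a => (X.unitsOf a).card) (Finset.mem_univ a))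

theorem varMuHat_le {δ Wl Wh M : ℝ} (hδ : 0 < δ) (hWl : 0 < Wl) (hWh : 0 < Wh)
    (hM : 0 < M) (h : X.AsymptoticAssumptions δ Wl Wh M) :
    X.varMuHat ≤ 2 * (M * Wh / (δ ^ 3 * Wl)) ^ 2 *
      ((X.degA : ℝ) ^ 3 * X.degR / Fintype.card A) := by
  classical
  set K := M * Wh / (δ ^ 3 * Wl)
  have hv : variance (fun T => ∑ a, X.betaHat a T * X.weightHat a T) X.law ≤
      2 * Fintype.card A * (X.degA * X.degR : ℕ) * (K * X.degA) ^ 2 :=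
    variance_sum_le_of_dependsOn (S := X.unitsOf)
      (fun a _ => dependsOn_betaHat_mul_weightHat h.toBasicAssumptions a)
      (fun a _ T => abs_betaHat_mul_weightHat_le hδ hWl hWh hM h a T)
      fun a _ => card_overlaps_unitsOf_le a
  have heq : X.varMuHat = (1 / (Fintype.card A : ℝ)) ^ 2 *
      variance (fun T => ∑ a, X.betaHat a T * X.weightHat a T) X.law :=
    variance_const_mul _ _ _
  rw [heq]
  refine (mul_le_mul_of_nonneg_left hv (by positivity)).trans (le_of_eq ?_)
  -- With no analysis units, division by zero makes both sides `0`.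
  rcases eq_or_ne (Fintype.card A : ℝ) 0 with h0 | h0
  · simp [h0]
  · push_cast
    field_simp

theorem law_real_abs_sub_ge_le {δ Wl Wh M : ℝ} (hδ : 0 < δ) (hWl : 0 < Wl)
    (h : X.AsymptoticAssumptions δ Wl Wh M) {ε : ℝ} (hε : 0 < ε) :
    X.law.real {T | ε ≤ |X.muHat T - X.tte|} ≤ X.varMuHat / ε ^ 2 := by
  have := meas_ge_le_variance_div_sq (μ := X.law) (X := X.muHat) .of_discrete hε
  rw [integral_muHat hδ hWl h] at this
  exact ENNReal.toReal_le_of_le_ofReal (div_nonneg (variance_nonneg _ _) (by positivity)) this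

/-- Quantitative asymptotic normality of the standardized estimator. -/
theorem norm_charFun_sub_le {δ Wl Wh M : ℝ} (hδ : 0 < δ) (hWl : 0 < Wl) (hWh : 0 < Wh)
    (hM : 0 < M) (h : X.AsymptoticAssumptions δ Wl Wh M) {κ : ℝ} (hκ : 0 < κ)
    (hvar : κ ≤ Fintype.card A * X.varMuHat) (t : ℝ) :
    ‖charFun (X.law.map fun T => (X.muHat T - X.tte) / Real.sqrt X.varMuHat) t -
        Complex.exp (-(t ^ 2 / 2))‖ ≤
      |t| * (|t| * Real.sqrt (8 * (16 * (M * Wh / (δ ^ 3 * Wl)) ^ 4 / κ ^ 2 *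
          ((X.degA : ℝ) ^ 10 * X.degR ^ 4 / Fintype.card A))) +
        2 * t ^ 2 * Real.sqrt (64 * (M * Wh / (δ ^ 3 * Wl)) ^ 6 / κ ^ 3 *
          ((X.degA : ℝ) ^ 10 * X.degR ^ 4 / Fintype.card A))) := by
  classical
  set K := M * Wh / (δ ^ 3 * Wl)
  set n : ℝ := (Fintype.card A : ℝ) with hn
  have hpos : 0 < n * X.varMuHat := hκ.trans_le hvar
  have hn0 : 0 < n := by
    refine lt_of_le_of_ne (by positivity) fun h0 => ?_
    rw [← h0, zero_mul] at hpos
    exact lt_irrefl _ hpos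
  have hv0 : 0 < X.varMuHat := (pos_iff_pos_of_mul_pos hpos).1 hn0
  have hs0 : 0 < Real.sqrt X.varMuHat := Real.sqrt_pos.2 hv0
  have hs2 : Real.sqrt X.varMuHat ^ 2 = X.varMuHat := Real.sq_sqrt hv0.le
  let τ : A → (R → Bool) → ℝ := fun a T => X.betaHat a T * X.weightHat a T
  let Z : A → (R → Bool) → ℝ := fun a T =>
    (τ a T - ∫ T', τ a T' ∂X.law) / (n * Real.sqrt X.varMuHat)
  have hZ : ∀ a, DependsOn (Z a) (X.unitsOf a : Set R) := fun a =>
    (dependsOn_betaHat_mul_weightHat h.toBasicAssumptions a).comp_left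
      fun y => (y - ∫ T', τ a T' ∂X.law) / (n * Real.sqrt X.varMuHat)
  have hZ0 : ∀ a, ∫ T, Z a T ∂X.law = 0 := fun a => by
    simp only [Z]
    rw [integral_div, integral_sub .of_finite .of_finite]
    simp
  have hτK : ∀ a T, |τ a T| ≤ K * X.degA := abs_betaHat_mul_weightHat_le hδ hWl hWh hM h
  set B : ℝ := 2 * (K * X.degA) / (n * Real.sqrt X.varMuHat) with hB
  have hZB : ∀ a T, |Z a T| ≤ B := fun a T => by
    have hI : |∫ T', τ a T' ∂X.law| ≤ K * X.degA := by
      simpa using norm_integral_le_of_norm_le_const (μ := X.law) (f := τ a) (.of_forall (hτK a))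
    simp only [Z]
    rw [abs_div, abs_of_pos (mul_pos hn0 hs0), hB]
    refine div_le_div_of_nonneg_right ?_ (by positivity)
    linarith [abs_sub (τ a T) (∫ T', τ a T' ∂X.law), hτK a T]
  have hsum : (fun T => ∑ a, Z a T) = fun T => (X.muHat T - X.tte) / Real.sqrt X.varMuHat := by
    funext T
    simp only [Z]
    rw [← Finset.sum_div, Finset.sum_sub_distrib, ← integral_muHat hδ hWl h]
    simp only [muHat]
    rw [integral_const_mul, integral_finsetSum _ fun _ _ => .of_finite, ← hn]
    simp only [τ]
    field_simp
  have hvarZ : variance (fun T => ∑ a, Z a T) X.law = 1 := by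
    rw [hsum]
    simp only [div_eq_mul_inv]
    rw [variance_mul_const, variance_sub_const .of_discrete, inv_pow, hs2]
    exact mul_inv_cancel₀ hv0.ne'
  have hmain := norm_charFun_sub_gaussian_le hZ hZ0 hvarZ hZB
    (fun a => card_overlaps_unitsOf_le a) t
  have hlaw : (Measure.pi fun _ : R => bernoulliMeasure true false X.p) = X.law := rfl
  rw [hlaw, hsum, ← hn] at hmain
  -- The variance lower bound enters here: `n² Var ≥ κ n`, so each standardized term has size `O(d_A
  -- / √n)`.
  have hB2 : B ^ 2 ≤ 4 * K ^ 2 * X.degA ^ 2 / (κ * n) := by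
    rw [hB, div_pow, mul_pow n, hs2]
    have : κ * n ≤ n ^ 2 * X.varMuHat := by nlinarith
    calc _ = 4 * K ^ 2 * (X.degA : ℝ) ^ 2 / (n ^ 2 * X.varMuHat) := by ring
      _ ≤ _ := div_le_div_of_nonneg_left (by positivity) (by positivity) this
  -- The quadratic error is of order `d_A⁷ d_R³ / n`. It is dominated by the rate of the Taylor
  -- error because a degree is either `0` or at least `1`.
  have hpow : (X.degA : ℝ) ^ 7 * X.degR ^ 3 ≤ (X.degA : ℝ) ^ 10 * X.degR ^ 4 := by
    have hmono : ∀ d i j : ℕ, 0 < i → i ≤ j → (d : ℝ) ^ i ≤ (d : ℝ) ^ j := by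
      intro d i j hi hij
      rcases Nat.eq_zero_or_pos d with rfl | hd
      · simp [hi.ne', (hi.trans_le hij).ne']
      · exact pow_le_pow_right₀ (mod_cast hd) hij
    exact mul_le_mul (hmono _ _ _ (by norm_num) (by norm_num))
      (hmono _ _ _ (by norm_num) (by norm_num)) (by positivity) (by positivity)
  have hfirst : n * ((X.degA * X.degR : ℕ) : ℝ) ^ 3 * B ^ 4 ≤
      16 * K ^ 4 / κ ^ 2 * ((X.degA : ℝ) ^ 10 * X.degR ^ 4 / n) := by
    calc n * ((X.degA * X.degR : ℕ) : ℝ) ^ 3 * B ^ 4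
        = n * ((X.degA * X.degR : ℕ) : ℝ) ^ 3 * (B ^ 2) ^ 2 := by ring
      _ ≤ n * ((X.degA * X.degR : ℕ) : ℝ) ^ 3 * (4 * K ^ 2 * X.degA ^ 2 / (κ * n)) ^ 2 := by
        gcongr
      _ = 16 * K ^ 4 / κ ^ 2 * ((X.degA : ℝ) ^ 7 * X.degR ^ 3 / n) := by
        push_cast
        field_simp
        ring
      _ ≤ _ := by gcongr
  have hsecond : |n * ((X.degA * X.degR : ℕ) : ℝ) ^ 2 * B ^ 3| ≤
      Real.sqrt (64 * K ^ 6 / κ ^ 3 * ((X.degA : ℝ) ^ 10 * X.degR ^ 4 / n)) := by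
    -- Only `B²` is controlled, so the odd power is squared: `D⁴ B⁶` contributes `d_A^(4+6) d_R⁴`,
    -- which is the origin of the rate in the normality condition.
    apply Real.abs_le_sqrt
    calc (n * ((X.degA * X.degR : ℕ) : ℝ) ^ 2 * B ^ 3) ^ 2
        = n ^ 2 * ((X.degA * X.degR : ℕ) : ℝ) ^ 4 * (B ^ 2) ^ 3 := by ring
      _ ≤ n ^ 2 * ((X.degA * X.degR : ℕ) : ℝ) ^ 4 * (4 * K ^ 2 * X.degA ^ 2 / (κ * n)) ^ 3 := by
        gcongr
      _ = _ := by
        push_cast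
        field_simp
        ring
  refine hmain.trans ?_
  gcongr

end Aggregate

end

end BipartiteExperiment

/-! ### Passage to the limit. -/

theorem theorem2 (δ Wl Wh M : ℝ) (hδ : 0 < δ) (hWl : 0 < Wl) (hWh : 0 < Wh) (hM : 0 < M) :
    (∃ C : ℝ, ∀ (nA nR : ℕ) (X : BipartiteExperiment (Fin nA) (Fin nR)),
      X.AsymptoticAssumptions δ Wl Wh M →
        X.varMuHat ≤ C * ((X.degA : ℝ) ^ 3 * (X.degR : ℝ) / (nA : ℝ))) ∧
    ∀ (nA nR : ℕ → ℕ) (X : ∀ n, BipartiteExperiment (Fin (nA n)) (Fin (nR n))),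
      (∀ n, (X n).AsymptoticAssumptions δ Wl Wh M) →
        (Tendsto (fun n => ((X n).degA : ℝ) ^ 3 * ((X n).degR : ℝ) / (nA n : ℝ)) atTop (𝓝 0) →
          ∀ ε : ℝ, 0 < ε →
            Tendsto (fun n => (X n).law.real {T | ε ≤ |(X n).muHat T - (X n).tte|})
              atTop (𝓝 0)) ∧
        ((∃ κ : ℝ, 0 < κ ∧ ∀ᶠ n in atTop, κ ≤ (nA n : ℝ) * (X n).varMuHat) →
          Tendsto (fun n => ((X n).degA : ℝ) ^ 10 * ((X n).degR : ℝ) ^ 4 / (nA n : ℝ))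
            atTop (𝓝 0) →
          TendstoInDistribution
            (fun n (T : Fin (nR n) → Bool) =>
              ((X n).muHat T - (X n).tte) / Real.sqrt (X n).varMuHat)
            atTop (id : ℝ → ℝ) (fun n => (X n).law) (gaussianReal 0 1)) := by
  have hV : ∀ (nA nR : ℕ) (X : BipartiteExperiment (Fin nA) (Fin nR)),
      X.AsymptoticAssumptions δ Wl Wh M →
        X.varMuHat ≤ 2 * (M * Wh / (δ ^ 3 * Wl)) ^ 2 *
          ((X.degA : ℝ) ^ 3 * (X.degR : ℝ) / (nA : ℝ)) := fun nA nR X h => by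
    simpa using BipartiteExperiment.varMuHat_le hδ hWl hWh hM h
  refine ⟨⟨_, hV⟩, fun nA nR X hX => ⟨fun hlim ε hε => ?_, ?_⟩⟩
  · refine squeeze_zero (fun _ => measureReal_nonneg)
      (fun n => (BipartiteExperiment.law_real_abs_sub_ge_le hδ hWl (hX n) hε).trans
        (div_le_div_of_nonneg_right (hV _ _ _ (hX n)) (by positivity))) ?_
    simpa using (hlim.const_mul (2 * (M * Wh / (δ ^ 3 * Wl)) ^ 2)).div_const (ε ^ 2)
  · rintro ⟨κ, hκ, hvar⟩ hlim
    refine ⟨fun n => Measurable.of_discrete.aemeasurable, aemeasurable_id, ?_⟩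
    refine ProbabilityMeasure.tendsto_iff_tendsto_charFun.2 fun t => ?_
    have hgauss : charFun ((gaussianReal 0 1).map (id : ℝ → ℝ)) t =
        Complex.exp (-((t : ℂ) ^ 2 / 2)) := by
      rw [Measure.map_id, charFun_gaussianReal]
      congr 1
      simp
    change Tendsto (fun n => charFun ((X n).law.map fun T =>
      ((X n).muHat T - (X n).tte) / Real.sqrt (X n).varMuHat) t) atTop
      (𝓝 (charFun ((gaussianReal 0 1).map (id : ℝ → ℝ)) t))
    rw [hgauss, tendsto_iff_norm_sub_tendsto_zero]
    refine squeeze_zero' (.of_forall fun _ => norm_nonneg _) (hvar.mono fun n hn =>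
      BipartiteExperiment.norm_charFun_sub_le hδ hWl hWh hM (hX n) hκ (by simpa using hn) t) ?_
    simp only [Fintype.card_fin]
    have hsq : ∀ C : ℝ, Tendsto (fun n => Real.sqrt
        (C * (((X n).degA : ℝ) ^ 10 * ((X n).degR : ℝ) ^ 4 / (nA n : ℝ)))) atTop (𝓝 0) :=
      fun C => by simpa using (hlim.const_mul C).sqrt
    simp only [← mul_assoc (8 : ℝ)]
    simpa using (((hsq _).const_mul |t|).add ((hsq _).const_mul (2 * t ^ 2))).const_mul |t|
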